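/- Let $n\in\mathbb N$, $m=\lfloor n/2\rfloor$, and let $\Theta$ be a real skew-symmetric $n\times n$ matrix. Let $\mathcal A_\Theta$ be the space of series $a=\sum_{k\in\mathbb Z^n}c_k\,e^{ik\cdot x}$ on the torus $\mathbb T^n=(\mathbb R/2\pi\mathbb Z)^n$ (with normalized Haar measure) with rapidly decreasing coefficients $(c_k)$, with complex conjugation as involution and with the Moyal product $\star_\Theta$ determined by $$e^{ik\cdot x}\star_\Theta e^{iq\cdot x}=e^{-\frac i2 k\cdot\Theta q}\,e^{i(k+q)\cdot x},$$ and let $L^\Theta(a)\psi=a\star_\Theta\psi$ be the bounded operator of left Moyal multiplication on $L^2(\mathbb T^n)$. Let $\omega_1,\dots,\omega_n,E\in\mathcal A_\Theta$ with $\omega_\mu^*=-\omega_\mu$ and $E\le 0$ (that is, $L^\Theta(E)$ is a nonpositive operator). On $\mathcal H=L^2(\mathbb T^n)\otimes\mathbb C^{2^m}$ consider the noncommutative generalized Laplacian $$\triangle^\Theta=-\Big(\sum_{\mu=1}^n\big(\partial_\mu+L^\Theta(\omega_\mu)\big)^2+L^\Theta(E)\Big)\otimes 1_{2^m},$$ where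 $\partial_\mu$ is the weak partial derivative in $L^2(\mathbb T^n)$ and sums and products of operators have their natural domains. Then $-\triangle^\Theta$ generates a unique strongly continuous one-parameter semigroup $(e^{-t\triangle^\Theta})_{t\ge0}$ of bounded operators on $\mathcal H$, and $e^{-t\triangle^\Theta}$ is trace-class for all $t>0$. -/

import Mathlib

open MeasureTheory Filter Topology
open scoped NNReal ENNReal InnerProductSpace

noncomputable section

namespace NCTorus

/-! ### Operators on Hilbert spaces -/

section Operators

universe u

variable {H : Type u} [NormedAddCommGroup H] [InnerProductSpace ℂ H]

/-- A bounded operator `T` is trace-class if `∑ ⟨b i, |T| b i⟩ < ∞` for some orthonormal basis `b`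
(equivalently for every one), where `|T| = (T* T)^{1/2}`. -/
def IsTraceClass [CompleteSpace H] (T : H →L[ℂ] H) : Prop :=
  ∃ (ι : Type u) (b : HilbertBasis ι ℂ H),
    Summable fun i => RCLike.re ⟪b i, CFC.abs T (b i)⟫_ℂ

/-- The product `B A` of partially defined operators, with its natural domain
`{x ∈ dom A | A x ∈ dom B}`. -/
def pcomp (B A : H →ₗ.[ℂ] H) : H →ₗ.[ℂ] H :=
  B.comp (A.domRestrict ((B.domain.comap A.toFun).map A.domain.subtype)) (by
    rintro ⟨x, hx⟩
    obtain ⟨⟨y, hy, hyx⟩, hx'⟩ := hx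
    subst hyx
    exact hy)

/-- A bounded operator, seen as an everywhere defined operator. -/
def everywhere (B : H →L[ℂ] H) : H →ₗ.[ℂ] H := (B : H →ₗ[ℂ] H).toPMap ⊤

/-- `T` is the strongly continuous one-parameter semigroup `T t = e^{-tA}`, `t ≥ 0`: its
infinitesimal generator, with the exact domain, is `-A`. -/
structure IsExpNeg (A : H →ₗ.[ℂ] H) (T : ℝ≥0 → H →L[ℂ] H) : Prop where
  map_zero : T 0 = 1
  map_add : ∀ s t, T (s + t) = T s * T t
  continuous : ∀ x, Continuous fun t => T t x
  generator : ∀ x y, (x, y) ∈ (-A).graph ↔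
    Tendsto (fun t : ℝ≥0 => (t : ℝ)⁻¹ • (T t x - x)) (𝓝[>] 0) (𝓝 y)

/-- The operator `A ⊗ 1` on `H ⊗ ℂ^N`, the latter being realized as the Hilbert space `H^N`:
`A` acts on each of the `N` components. -/
def ampliation (N : ℕ) (A : H →ₗ.[ℂ] H) :
    PiLp 2 (fun _ : Fin N => H) →ₗ.[ℂ] PiLp 2 (fun _ : Fin N => H) where
  domain :=
    { carrier := {ψ | ∀ j, ψ j ∈ A.domain}
      add_mem' := fun h₁ h₂ j => A.domain.add_mem (h₁ j) (h₂ j)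
      zero_mem' := fun _ => A.domain.zero_mem
      smul_mem' := fun c _ h j => A.domain.smul_mem c (h j) }
  toFun :=
    { toFun := fun ψ => WithLp.toLp 2 fun j => A ⟨ψ.1 j, ψ.2 j⟩
      map_add' := by
        intro ψ φ
        ext j
        exact A.map_add ⟨ψ.1 j, ψ.2 j⟩ ⟨φ.1 j, φ.2 j⟩
      map_smul' := by
        intro c ψ
        ext j
        exact A.map_smul c ⟨ψ.1 j, ψ.2 j⟩ }

end Operators

/-! ### The noncommutative torus -/

variable {n : ℕ}

/-- The Hilbert space `L²(𝕋ⁿ)`, for the normalized Haar measure of `𝕋ⁿ = (ℝ/2πℤ)ⁿ`. A point with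
angular coordinates `x_μ ∈ ℝ/2πℤ` is represented by `(x_μ/2π)_μ` in `UnitAddTorus (Fin n)`. -/
abbrev TorusL2 (n : ℕ) : Type :=
  Lp ℂ 2 (Measure.pi fun _ : Fin n => (AddCircle.haarAddCircle : Measure UnitAddCircle))

/-- The orthonormal basis of plane waves `e^{ik·x}`, `k ∈ ℤⁿ`, of `L²(𝕋ⁿ)`. -/
def wave (n : ℕ) : HilbertBasis (Fin n → ℤ) ℂ (TorusL2 n) := UnitAddTorus.mFourierBasis

/-- The number `k · Θ q`. -/
def pairing (Θ : Matrix (Fin n) (Fin n) ℝ) (k q : Fin n → ℤ) : ℝ :=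
  (fun i => (k i : ℝ)) ⬝ᵥ (Θ.mulVec fun i => (q i : ℝ))

/-- The phase in the Moyal product `e^{ik·x} ⋆ e^{iq·x} = e^{-(i/2) k·Θq} e^{i(k+q)·x}`. -/
def phase (Θ : Matrix (Fin n) (Fin n) ℝ) (k q : Fin n → ℤ) : ℂ :=
  Complex.exp (-(Complex.I / 2) * (pairing Θ k q : ℂ))

theorem norm_phase (Θ : Matrix (Fin n) (Fin n) ℝ) (k q : Fin n → ℤ) : ‖phase Θ k q‖ = 1 := by
  have h : -(Complex.I / 2) * (pairing Θ k q : ℂ)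
      = ((-(pairing Θ k q) / 2 : ℝ) : ℂ) * Complex.I := by
    push_cast
    ring
  rw [phase, h, Complex.norm_exp_ofReal_mul_I]

/-- The family `q ↦ e^{ik·x} ⋆ e^{iq·x}` is orthonormal. -/
theorem orthonormal_star_wave (Θ : Matrix (Fin n) (Fin n) ℝ) (k : Fin n → ℤ) :
    Orthonormal ℂ fun q => phase Θ k q • wave n (k + q) := by
  have hw := (wave n).orthonormal
  constructor
  · intro q
    rw [norm_smul, norm_phase, hw.1, one_mul]
  · intro q q' hq
    simp only [inner_smul_left, inner_smul_right]
    rw [hw.2 (fun h => hq (add_left_cancel h))]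
    simp

/-- Left Moyal multiplication by the plane wave `e^{ik·x}` on `L²(𝕋ⁿ)`: the bounded operator with
`e^{iq·x} ↦ e^{ik·x} ⋆ e^{iq·x} = e^{-(i/2) k·Θq} e^{i(k+q)·x}` for all `q`
(see `leftMulWave_apply_wave`). -/
def leftMulWave (Θ : Matrix (Fin n) (Fin n) ℝ) (k : Fin n → ℤ) : TorusL2 n →L[ℂ] TorusL2 n :=
  (orthonormal_star_wave Θ k).orthogonalFamily.linearIsometry.toContinuousLinearMap ∘L
    ((wave n).repr.toContinuousLinearEquiv : TorusL2 n →L[ℂ] _)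

theorem leftMulWave_apply_wave (Θ : Matrix (Fin n) (Fin n) ℝ) (k q : Fin n → ℤ) :
    leftMulWave Θ k (wave n q) = phase Θ k q • wave n (k + q) := by
  classical
  change (orthonormal_star_wave Θ k).orthogonalFamily.linearIsometry
    ((wave n).repr (wave n q)) = _
  rw [HilbertBasis.repr_self, OrthogonalFamily.linearIsometry_apply_single]
  simp

variable (n) in
/-- The smooth algebra of the noncommutative torus: an element is a series `∑ c_k e^{ik·x}`,
`k ∈ ℤⁿ`, with rapidly decreasing coefficients. -/
structure SmoothAlgebra where
  coeff : (Fin n → ℤ) → ℂ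
  rapidDecay : ∀ N : ℕ, ∃ C : ℝ, ∀ k, (1 + ‖k‖) ^ N * ‖coeff k‖ ≤ C

/-- The involution of the smooth algebra is the complex conjugation of functions. -/
instance : Star (SmoothAlgebra n) where
  star a :=
    { coeff := fun k => star (a.coeff (-k))
      rapidDecay := fun N => by
        obtain ⟨C, hC⟩ := a.rapidDecay N
        exact ⟨C, fun k => by simpa using hC (-k)⟩ }

instance : Neg (SmoothAlgebra n) where
  neg a :=
    { coeff := fun k => -a.coeff k
      rapidDecay := fun N => by
        obtain ⟨C, hC⟩ := a.rapidDecay N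
        exact ⟨C, fun k => by simpa using hC k⟩ }

/-- Left Moyal multiplication `L^Θ(a) ψ = a ⋆ ψ` on `L²(𝕋ⁿ)`, for `a = ∑ c_k e^{ik·x}` in the smooth
algebra (the series converges in operator norm, see `summable_leftMul`). -/
def leftMul (Θ : Matrix (Fin n) (Fin n) ℝ) (a : SmoothAlgebra n) : TorusL2 n →L[ℂ] TorusL2 n :=
  ∑' k, a.coeff k • leftMulWave Θ k

theorem norm_leftMulWave_le (Θ : Matrix (Fin n) (Fin n) ℝ) (k : Fin n → ℤ) :
    ‖leftMulWave Θ k‖ ≤ 1 := by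
  refine ContinuousLinearMap.opNorm_le_bound _ zero_le_one fun ψ => ?_
  change ‖(orthonormal_star_wave Θ k).orthogonalFamily.linearIsometry ((wave n).repr ψ)‖ ≤ _
  rw [LinearIsometry.norm_map, LinearIsometryEquiv.norm_map, one_mul]

theorem summable_leftMul (Θ : Matrix (Fin n) (Fin n) ℝ) (a : SmoothAlgebra n) :
    Summable fun k => a.coeff k • leftMulWave Θ k := by
  set L : Submodule ℤ (Fin n → ℝ) := Submodule.span ℤ (Set.range (Pi.basisFun ℝ (Fin n))) with hL
  have hmem : ∀ k : Fin n → ℤ, (fun i => (k i : ℝ)) ∈ L := by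
    intro k
    rw [hL, Module.Basis.mem_span_iff_repr_mem]
    intro i
    exact ⟨k i, by simp⟩
  have hnorm : ∀ k : Fin n → ℤ, ‖(⟨_, hmem k⟩ : L)‖ = ‖k‖ := by
    intro k
    change ‖fun i => (k i : ℝ)‖ = ‖k‖
    simp only [Pi.norm_def]
    congr 1
  have hinj : Function.Injective fun k : Fin n → ℤ => (⟨_, hmem k⟩ : L) := by
    intro k q h
    funext i
    have := congrFun (congrArg Subtype.val h) i
    simpa using this
  have hs := (ZLattice.summable_norm_pow_inv L _ (Nat.lt_succ_self _)).comp_injective hinj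
  simp only [Function.comp_def, hnorm] at hs
  obtain ⟨C, hC⟩ := a.rapidDecay (Module.finrank ℤ L).succ
  refine Summable.of_norm_bounded_eventually (hs.mul_left C) ?_
  refine ((Set.finite_singleton (0 : Fin n → ℤ)).subset ?_)
  intro k hk
  by_contra h0
  refine hk ?_
  have hpos : 0 < ‖k‖ := norm_pos_iff.mpr h0
  have h1 : ‖k‖ ^ (Module.finrank ℤ L).succ * ‖a.coeff k‖ ≤ C := by
    refine le_trans ?_ (hC k)
    gcongr
    linarith
  have h2 : ‖a.coeff k • leftMulWave Θ k‖ ≤ ‖a.coeff k‖ := by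
    rw [norm_smul]
    exact mul_le_of_le_one_right (norm_nonneg _) (norm_leftMulWave_le Θ k)
  refine h2.trans ?_
  rw [inv_pow, ← div_eq_mul_inv, le_div_iff₀ (by positivity), mul_comm]
  exact h1

/-- The graph of the partial derivative `∂_μ = ∂/∂x_μ` on `L²(𝕋ⁿ)` in the weak sense: `φ = ∂_μ ψ` if
the Fourier coefficients satisfy `φ_k = i k_μ ψ_k` (that is, if `∫ f φ = -∫ (∂_μ f) ψ` for all
plane waves `f`). -/
def derivGraph (μ : Fin n) : Submodule ℂ (TorusL2 n × TorusL2 n) where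
  carrier := {p | ∀ k, (wave n).repr p.2 k = Complex.I * (k μ : ℂ) * (wave n).repr p.1 k}
  add_mem' := by
    intro p q hp hq k
    simp only [Set.mem_ofPred_eq] at hp hq
    simp only [Prod.fst_add, Prod.snd_add, map_add, lp.coeFn_add, Pi.add_apply, hp k, hq k]
    ring
  zero_mem' := by
    intro k
    simp
  smul_mem' := by
    intro c p hp k
    simp only [Set.mem_ofPred_eq] at hp
    simp only [Prod.smul_fst, Prod.smul_snd, map_smul, lp.coeFn_smul, Pi.smul_apply, hp k,
      smul_eq_mul]
    ring

/-- The operator `∂_μ`, with graph `derivGraph μ` (see `graph_pd`): its domain consists of the `ψ`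
whose weak derivative is in `L²(𝕋ⁿ)`. -/
def pd (μ : Fin n) : TorusL2 n →ₗ.[ℂ] TorusL2 n := (derivGraph μ).toLinearPMap

theorem graph_pd (μ : Fin n) : (pd μ).graph = derivGraph μ := by
  refine Submodule.toLinearPMap_graph_eq _ ?_
  rintro ⟨ψ, φ⟩ h hψ
  simp only at hψ
  subst hψ
  apply (wave n).repr.injective
  ext k
  have := h k
  simpa using this

/-- The covariant derivative `∂_μ + L^Θ(ω_μ)`. -/
def covDeriv (Θ : Matrix (Fin n) (Fin n) ℝ) (ω : Fin n → SmoothAlgebra n) (μ : Fin n) :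
    TorusL2 n →ₗ.[ℂ] TorusL2 n :=
  pd μ + everywhere (leftMul Θ (ω μ))

/-- The scalar generalized Laplacian
`-(∑_μ (∂_μ + L^Θ(ω_μ)) (∂_μ + L^Θ(ω_μ)) + L^Θ(E))` on `L²(𝕋ⁿ)`, on its natural domain (the
functions on which all these operations make sense in `L²`, that is the Sobolev space `H²(𝕋ⁿ)`). -/
def scalarLaplacian (Θ : Matrix (Fin n) (Fin n) ℝ) (ω : Fin n → SmoothAlgebra n)
    (E : SmoothAlgebra n) : TorusL2 n →ₗ.[ℂ] TorusL2 n :=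
  -(∑ μ, pcomp (covDeriv Θ ω μ) (covDeriv Θ ω μ) + everywhere (leftMul Θ E))

/-- The Hilbert space `L²(𝕋ⁿ) ⊗ ℂ^{2^m}`, `m = ⌊n/2⌋`, as `2^m`-tuples of elements of `L²(𝕋ⁿ)`. -/
abbrev SpinorL2 (n : ℕ) : Type := PiLp 2 (fun _ : Fin (2 ^ (n / 2)) => TorusL2 n)

/-- The noncommutative generalized Laplacian, the scalar one tensored with the identity of
`ℂ^{2^m}`. -/
def laplacian (Θ : Matrix (Fin n) (Fin n) ℝ) (ω : Fin n → SmoothAlgebra n)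
    (E : SmoothAlgebra n) : SpinorL2 n →ₗ.[ℂ] SpinorL2 n :=
  ampliation (2 ^ (n / 2)) (scalarLaplacian Θ ω E)

end NCTorus

end

/-!
The scalar operator `A = -(∑ (∂_μ + L(ω_μ))² + L(E))` is shown to be diagonal in a Hilbert basis of
`L²(𝕋ⁿ)`, with eigenvalues `lam i ≥ 0` such that `∑ e^{-t lam i} < ∞` for all `t > 0`
(`exists_isDiagonal_scalarLaplacian`). Everything then follows from a statement about diagonal
operators (`IsDiagonal.exists_unique_traceClass`), applied to `A ⊗ 1`.

*Compact resolvent.* By the Leibniz rule, `(A + s²) (-∑ ∂_μ² + s²)⁻¹ = 1 - K` where `K` collects the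
terms of order at most one, so that `‖K‖ = O(1/s)`. For large `s` a Neumann series gives the compact
right inverse `(-∑ ∂_μ² + s²)⁻¹ (1 - K)⁻¹` of `A + s²` (`exists_compact_resolvent`). Its range lies
in the natural domain of `A`, on which `A` is symmetric because the covariant derivatives are skew;
a symmetric operator with a compact right inverse of a shift is diagonal, with exactly the
maximal domain (`exists_isDiagonal_of_compact_resolvent`). No a priori description of the domain of
`A` as a Sobolev space is needed.

*Heat trace.* Integration by parts gives `⟨ψ, Aψ⟩ ≥ ½ ‖∇ψ‖² - C ‖ψ‖²`
(`exists_hasSum_le_inner_scalarLaplacian`). For an eigenvector `ψ = b i` the right side is the mean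
of `½ |k|² - C` for the probability weights `|ψ_k|²`, so by Jensen's inequality
`e^{-t lam i} ≤ ∑_k |(b i)_k|² e^{-t (|k|²/2 - C)}`. Summing over `i` leaves a convergent Gaussian sum
over `ℤⁿ` (`summable_exp_neg_of_expectation_le`).

*Semigroup.* `e^{-tA}` acts by `e^{-t lam i}` on `b i`. Its generator, with domain, is computed by
dominated convergence (`IsDiagonal.isExpNeg_heat`). For uniqueness it is enough to note that the
orbit of each `b i` under any semigroup generated by `-A` solves a linear ODE
(`IsExpNeg.apply_eigenvector`).
-/

noncomputable section

namespace NCTorus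

/-! ### Graphs of sums and products -/

section Graphs

variable {H : Type*} [NormedAddCommGroup H] [InnerProductSpace ℂ H]

theorem mem_graph_pcomp {B A : H →ₗ.[ℂ] H} {x z : H} :
    (x, z) ∈ (pcomp B A).graph ↔ ∃ y, (x, y) ∈ A.graph ∧ (y, z) ∈ B.graph := by
  simp only [LinearPMap.mem_graph_iff]
  constructor
  · rintro ⟨⟨x, hx⟩, rfl, rfl⟩
    obtain ⟨⟨y, hy, rfl⟩, hx'⟩ := hx
    exact ⟨A y, ⟨y, rfl, rfl⟩, ⟨⟨A y, hy⟩, rfl, rfl⟩⟩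
  · rintro ⟨_, ⟨x, rfl, rfl⟩, ⟨y, hy, rfl⟩⟩
    change (y : H) = A x at hy
    have hmem : A x ∈ B.domain := hy ▸ y.2
    refine ⟨⟨x, ⟨⟨x, hmem, rfl⟩, x.2⟩⟩, rfl, ?_⟩
    have : y = ⟨A x, hmem⟩ := Subtype.ext hy
    rw [this]
    rfl

theorem mem_graph_add {A B : H →ₗ.[ℂ] H} {x z : H} :
    (x, z) ∈ (A + B).graph ↔ ∃ y y', (x, y) ∈ A.graph ∧ (x, y') ∈ B.graph ∧ z = y + y' := by
  simp only [LinearPMap.mem_graph_iff]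
  constructor
  · rintro ⟨⟨x, hxA, hxB⟩, rfl, rfl⟩
    exact ⟨A ⟨x, hxA⟩, B ⟨x, hxB⟩, ⟨⟨x, hxA⟩, rfl, rfl⟩, ⟨⟨x, hxB⟩, rfl, rfl⟩, rfl⟩
  · rintro ⟨_, _, ⟨⟨x, hxA⟩, rfl, rfl⟩, ⟨⟨x', hxB⟩, h, rfl⟩, rfl⟩
    simp only at h
    subst h
    exact ⟨⟨x', hxA, hxB⟩, rfl, rfl⟩

theorem mem_graph_sum {ι : Type*} {A : ι → H →ₗ.[ℂ] H} {s : Finset ι} {x z : H} :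
    (x, z) ∈ (∑ i ∈ s, A i).graph ↔
      ∃ y : ι → H, (∀ i ∈ s, (x, y i) ∈ (A i).graph) ∧ z = ∑ i ∈ s, y i := by
  classical
  induction s using Finset.induction_on generalizing z with
  | empty =>
    simp only [Finset.sum_empty, Finset.notMem_empty, false_imp_iff, implies_true, true_and,
      LinearPMap.mem_graph_iff]
    constructor
    · rintro ⟨y, _, rfl⟩
      exact ⟨0, rfl⟩
    · rintro ⟨_, rfl⟩
      exact ⟨⟨x, trivial⟩, rfl, rfl⟩
  | insert i s hi ih =>
    rw [Finset.sum_insert hi, mem_graph_add]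
    constructor
    · rintro ⟨y, y', hy, hy', rfl⟩
      obtain ⟨w, hw, rfl⟩ := ih.mp hy'
      refine ⟨Function.update w i y, fun j hj => ?_, ?_⟩
      · rcases Finset.mem_insert.mp hj with rfl | hj
        · simpa using hy
        · rw [Function.update_of_ne (ne_of_mem_of_not_mem hj hi)]
          exact hw j hj
      · rw [Finset.sum_insert hi, Function.update_self]
        congr 1
        refine Finset.sum_congr rfl fun j hj => ?_
        rw [Function.update_of_ne (ne_of_mem_of_not_mem hj hi)]
    · rintro ⟨w, hw, rfl⟩
      exact ⟨w i, ∑ j ∈ s, w j, hw i (Finset.mem_insert_self i s),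
        ih.mpr ⟨w, fun j hj => hw j (Finset.mem_insert_of_mem hj), rfl⟩, Finset.sum_insert hi⟩

theorem mem_graph_neg {A : H →ₗ.[ℂ] H} {x z : H} : (x, z) ∈ (-A).graph ↔ (x, -z) ∈ A.graph := by
  simp [LinearPMap.mem_graph_iff, LinearPMap.neg_apply, neg_eq_iff_eq_neg]

theorem mem_graph_everywhere {B : H →L[ℂ] H} {x z : H} :
    (x, z) ∈ (everywhere B).graph ↔ z = B x := by
  rw [LinearPMap.mem_graph_iff]
  constructor
  · rintro ⟨y, rfl, rfl⟩
    rfl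
  · rintro rfl
    exact ⟨⟨x, trivial⟩, rfl, rfl⟩

end Graphs

/-! ### Operators diagonal in a Hilbert basis -/

section Diagonal

universe u

variable {ι : Type*} {H : Type u} [NormedAddCommGroup H] [InnerProductSpace ℂ H]

theorem hasSum_norm_sq_inner (b : HilbertBasis ι ℂ H) (x : H) :
    HasSum (fun i => ‖⟪b i, x⟫_ℂ‖ ^ 2) (‖x‖ ^ 2) := by
  have h := (b.hasSum_inner_mul_inner x x).mapL Complex.reCLM
  have h2 : Complex.reCLM ⟪x, x⟫_ℂ = ‖x‖ ^ 2 := by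
    rw [inner_self_eq_norm_sq_to_K]
    simp [← Complex.ofReal_pow]
  rw [h2] at h
  refine h.congr_fun fun i => ?_
  rw [← inner_conj_symm x (b i), ← Complex.normSq_eq_conj_mul_self, Complex.normSq_eq_norm_sq]
  exact (Complex.ofReal_re _).symm

theorem eq_of_forall_inner_eq (b : HilbertBasis ι ℂ H) {x y : H}
    (h : ∀ i, ⟪b i, x⟫_ℂ = ⟪b i, y⟫_ℂ) : x = y := by
  have hs := hasSum_norm_sq_inner b (x - y)
  have h0 : (fun i => ‖⟪b i, x - y⟫_ℂ‖ ^ 2) = fun _ => 0 := by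
    funext i
    rw [inner_sub_right, h i, sub_self]
    simp
  rw [h0] at hs
  have := hs.unique hasSum_zero
  rw [sq_eq_zero_iff, norm_eq_zero, sub_eq_zero] at this
  exact this

/-- Norm convergence from convergence of the coordinates, by dominated convergence for the squared
distance. -/
theorem tendsto_of_tendsto_inner (b : HilbertBasis ι ℂ H) {α : Type*} {l : Filter α}
    {f : α → H} {y : H} {bound : ι → ℝ} (hb : Summable bound)
    (hf : ∀ i, Tendsto (fun a => ⟪b i, f a⟫_ℂ) l (𝓝 ⟪b i, y⟫_ℂ))
    (hbound : ∀ᶠ a in l, ∀ i, ‖⟪b i, f a⟫_ℂ - ⟪b i, y⟫_ℂ‖ ^ 2 ≤ bound i) :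
    Tendsto f l (𝓝 y) := by
  have h1 : Tendsto (fun a => ∑' i, ‖⟪b i, f a⟫_ℂ - ⟪b i, y⟫_ℂ‖ ^ 2) l (𝓝 (∑' _ : ι, (0 : ℝ))) := by
    refine tendsto_tsum_of_dominated_convergence hb (fun i => ?_) ?_
    · have := ((hf i).sub_const ⟪b i, y⟫_ℂ).norm.pow 2
      simpa using this
    · filter_upwards [hbound] with a ha i
      rw [Real.norm_of_nonneg (by positivity)]
      exact ha i
  have h2 : ∀ a, ∑' i, ‖⟪b i, f a⟫_ℂ - ⟪b i, y⟫_ℂ‖ ^ 2 = ‖f a - y‖ ^ 2 := fun a => by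
    rw [← (hasSum_norm_sq_inner b (f a - y)).tsum_eq]
    simp only [inner_sub_right]
  simp only [h2, tsum_zero] at h1
  rw [tendsto_iff_norm_sub_tendsto_zero]
  have h3 := h1.sqrt
  simpa [Real.sqrt_sq] using h3

/-- The bounded operator `b i ↦ m i • b i`, for a bounded family `m` of multipliers. -/
def diagOp (b : HilbertBasis ι ℂ H) (m : ι → ℂ) {K : ℝ} (hm : ∀ i, ‖m i‖ ≤ K) : H →L[ℂ] H :=
  (b.repr.symm.toContinuousLinearEquiv : _ →L[ℂ] H) ∘L
    lp.mapCLM 2 (fun i => m i • ContinuousLinearMap.id ℂ ℂ) (abs_nonneg K) (fun i => by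
      rw [norm_smul, ContinuousLinearMap.norm_id, mul_one]
      exact (hm i).trans (le_abs_self K)) ∘L
    (b.repr.toContinuousLinearEquiv : H →L[ℂ] _)

theorem inner_diagOp (b : HilbertBasis ι ℂ H) (m : ι → ℂ) {K : ℝ} (hm : ∀ i, ‖m i‖ ≤ K)
    (x : H) (i : ι) : ⟪b i, diagOp b m hm x⟫_ℂ = m i * ⟪b i, x⟫_ℂ := by
  rw [← b.repr_apply_apply, ← b.repr_apply_apply]
  simp [diagOp]

theorem norm_diagOp_le (b : HilbertBasis ι ℂ H) (m : ι → ℂ) {K : ℝ} (hm : ∀ i, ‖m i‖ ≤ K)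
    (hK : 0 ≤ K) : ‖diagOp b m hm‖ ≤ K := by
  refine ContinuousLinearMap.opNorm_le_bound _ hK fun x => ?_
  refine le_of_sq_le_sq ?_ (by positivity)
  rw [mul_pow]
  refine hasSum_le (fun i => ?_) (hasSum_norm_sq_inner b _)
    ((hasSum_norm_sq_inner b x).mul_left (K ^ 2))
  rw [inner_diagOp, norm_mul, mul_pow]
  gcongr
  exact hm i

theorem isPositive_diagOp (b : HilbertBasis ι ℂ H) (m : ι → ℝ) {K : ℝ}
    (hm : ∀ i, ‖(m i : ℂ)‖ ≤ K) (h0 : ∀ i, 0 ≤ m i) :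
    (diagOp b (fun i => (m i : ℂ)) hm).IsPositive := by
  rw [ContinuousLinearMap.isPositive_iff_complex]
  intro x
  have h := b.hasSum_inner_mul_inner (diagOp b (fun i => (m i : ℂ)) hm x) x
  have h1 : ∀ i, ⟪diagOp b (fun i => (m i : ℂ)) hm x, b i⟫_ℂ * ⟪b i, x⟫_ℂ
      = ((m i * ‖⟪b i, x⟫_ℂ‖ ^ 2 : ℝ) : ℂ) := fun i => by
    rw [← inner_conj_symm, inner_diagOp, map_mul, Complex.conj_ofReal, mul_assoc,
      ← Complex.normSq_eq_conj_mul_self, Complex.normSq_eq_norm_sq]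
    push_cast
    rfl
  simp only [h1] at h
  have h2 : Summable fun i => m i * ‖⟪b i, x⟫_ℂ‖ ^ 2 := by
    exact Complex.summable_ofReal.mp h.summable
  have h3 := h.unique (Complex.hasSum_ofReal.mpr h2.hasSum)
  rw [h3]
  exact ⟨by simp, tsum_nonneg fun i => mul_nonneg (h0 i) (by positivity)⟩

/-- The partially defined operator `A` is the maximal operator with `b i ↦ lam i • b i`: it consists
of all pairs `(x, y)` whose coordinates satisfy `y i = lam i * x i`. -/
def IsDiagonal (A : H →ₗ.[ℂ] H) (b : HilbertBasis ι ℂ H) (lam : ι → ℝ) : Prop :=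
  ∀ x y, (x, y) ∈ A.graph ↔ ∀ i, ⟪b i, y⟫_ℂ = (lam i : ℂ) * ⟪b i, x⟫_ℂ

theorem IsDiagonal.mem_graph {A : H →ₗ.[ℂ] H} {b : HilbertBasis ι ℂ H} {lam : ι → ℝ}
    (hA : IsDiagonal A b lam) (i : ι) : (b i, (lam i : ℂ) • b i) ∈ A.graph := by
  classical
  rw [hA]
  intro j
  rw [inner_smul_right, orthonormal_iff_ite.mp b.orthonormal j i]
  split_ifs with h
  · rw [h]
  · simp

theorem norm_exp_neg_mul_le {lam : ι → ℝ} (h0 : ∀ i, 0 ≤ lam i) (t : ℝ≥0) (i : ι) :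
    ‖((Real.exp (-(t * lam i)) : ℝ) : ℂ)‖ ≤ 1 := by
  rw [Complex.norm_real, Real.norm_of_nonneg (Real.exp_pos _).le, Real.exp_le_one_iff,
    neg_nonpos]
  exact mul_nonneg t.2 (h0 i)

/-- The operators `b i ↦ e^{-t lam i} • b i`. -/
def heat (b : HilbertBasis ι ℂ H) {lam : ι → ℝ} (h0 : ∀ i, 0 ≤ lam i) (t : ℝ≥0) : H →L[ℂ] H :=
  diagOp b _ (norm_exp_neg_mul_le h0 t)

theorem inner_heat (b : HilbertBasis ι ℂ H) {lam : ι → ℝ} (h0 : ∀ i, 0 ≤ lam i) (t : ℝ≥0) (x : H)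
    (i : ι) : ⟪b i, heat b h0 t x⟫_ℂ = ((Real.exp (-(t * lam i)) : ℝ) : ℂ) * ⟪b i, x⟫_ℂ :=
  inner_diagOp b _ _ x i

theorem continuous_heat_apply (b : HilbertBasis ι ℂ H) {lam : ι → ℝ} (h0 : ∀ i, 0 ≤ lam i) (x : H) :
    Continuous fun t => heat b h0 t x := by
  rw [continuous_iff_continuousAt]
  intro s
  refine tendsto_of_tendsto_inner b (hasSum_norm_sq_inner b x).summable (fun i => ?_)
    (Eventually.of_forall fun t i => ?_)
  · simp only [inner_heat]
    have : Continuous fun t : ℝ≥0 => ((Real.exp (-(t * lam i)) : ℝ) : ℂ) * ⟪b i, x⟫_ℂ := by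
      fun_prop
    exact this.tendsto s
  · rw [inner_heat, inner_heat, ← sub_mul, norm_mul, mul_pow]
    refine mul_le_of_le_one_left (by positivity) (pow_le_one₀ (norm_nonneg _) ?_)
    rw [← Complex.ofReal_sub, Complex.norm_real, Real.norm_eq_abs, abs_le]
    have h1 := norm_exp_neg_mul_le h0 t i
    have h2 := norm_exp_neg_mul_le h0 s i
    rw [Complex.norm_real, Real.norm_of_nonneg (Real.exp_pos _).le] at h1 h2
    have h3 := Real.exp_pos (-(t * lam i))
    have h4 := Real.exp_pos (-(s * lam i))
    constructor <;> linarith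

theorem tendsto_exp_quotient (l : ℝ) :
    Tendsto (fun t : ℝ≥0 => (t : ℝ)⁻¹ * (Real.exp (-(t * l)) - 1)) (𝓝[>] 0) (𝓝 (-l)) := by
  have h : HasDerivAt (fun t : ℝ => Real.exp (-(t * l))) (-l) 0 := by
    have := ((hasDerivAt_id (0 : ℝ)).mul_const l).neg.exp
    simpa using this
  have h2 := (hasDerivWithinAt_iff_tendsto_slope' (s := Set.Ioi (0 : ℝ)) (by simp)).mp
    h.hasDerivWithinAt
  have h3 : Tendsto (fun t : ℝ≥0 => (t : ℝ)) (𝓝[>] 0) (𝓝[>] 0) := by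
    refine tendsto_nhdsWithin_iff.mpr ⟨?_, ?_⟩
    · exact (NNReal.continuous_coe.tendsto 0).mono_left nhdsWithin_le_nhds
    · filter_upwards [self_mem_nhdsWithin] with t ht
      exact ht
  refine (h2.comp h3).congr fun t => ?_
  simp [slope_def_field, div_eq_inv_mul]

theorem inner_difference_quotient (b : HilbertBasis ι ℂ H) {lam : ι → ℝ} (h0 : ∀ i, 0 ≤ lam i)
    (t : ℝ≥0) (x : H) (i : ι) : ⟪b i, (t : ℝ)⁻¹ • (heat b h0 t x - x)⟫_ℂ
      = (((t : ℝ)⁻¹ * (Real.exp (-(t * lam i)) - 1) : ℝ) : ℂ) * ⟪b i, x⟫_ℂ := by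
  rw [← Complex.coe_smul, inner_smul_right, inner_sub_right, inner_heat]
  push_cast
  ring

/-- The semigroup `heat` has the diagonal operator as its generator, with exact domain: the
coordinates of the difference quotients are dominated by those of the limit, since
`0 ≤ 1 - e^{-s} ≤ s`. -/
theorem IsDiagonal.isExpNeg_heat {A : H →ₗ.[ℂ] H} {b : HilbertBasis ι ℂ H} {lam : ι → ℝ}
    (hA : IsDiagonal A b lam) (h0 : ∀ i, 0 ≤ lam i) : IsExpNeg A (heat b h0) where
  map_zero := by
    ext x
    refine eq_of_forall_inner_eq b fun i => ?_
    rw [inner_heat]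
    simp
  map_add s t := by
    ext x
    refine eq_of_forall_inner_eq b fun i => ?_
    rw [ContinuousLinearMap.mul_def, ContinuousLinearMap.comp_apply, inner_heat, inner_heat,
      inner_heat, ← mul_assoc, ← Complex.ofReal_mul, ← Real.exp_add]
    congr 3
    push_cast
    ring
  continuous := continuous_heat_apply b h0
  generator x y := by
    have hcoord : ∀ i, Tendsto (fun t : ℝ≥0 => ⟪b i, (t : ℝ)⁻¹ • (heat b h0 t x - x)⟫_ℂ) (𝓝[>] 0)
        (𝓝 (((-lam i : ℝ) : ℂ) * ⟪b i, x⟫_ℂ)) := fun i => by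
      simp only [inner_difference_quotient]
      exact ((Complex.continuous_ofReal.tendsto _).comp (tendsto_exp_quotient (lam i))).mul_const _
    rw [mem_graph_neg, hA]
    constructor
    · intro h
      have hy : ∀ i, ⟪b i, y⟫_ℂ = ((-lam i : ℝ) : ℂ) * ⟪b i, x⟫_ℂ := fun i => by
        have := h i
        rw [inner_neg_right, neg_eq_iff_eq_neg] at this
        rw [this]
        push_cast
        ring
      refine tendsto_of_tendsto_inner b (hasSum_norm_sq_inner b y).summable (fun i => ?_) ?_
      · rw [hy i]
        exact hcoord i
      · filter_upwards [self_mem_nhdsWithin] with t ht i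
        have ht' : (0 : ℝ) < t := ht
        rw [inner_difference_quotient, hy i, ← sub_mul, norm_mul, norm_mul, ← Complex.ofReal_sub,
          Complex.norm_real, Complex.norm_real]
        gcongr
        have h1 : 0 ≤ 1 - Real.exp (-(t * lam i)) := by
          have := Real.exp_le_one_iff.mpr (neg_nonpos.mpr (mul_nonneg t.2 (h0 i)))
          exact sub_nonneg.mpr this
        have h2 : 1 - Real.exp (-(t * lam i)) ≤ t * lam i := by
          have := Real.add_one_le_exp (-(t * lam i))
          linarith
        have h3 : 0 ≤ (t : ℝ)⁻¹ * (1 - Real.exp (-(t * lam i))) := by positivity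
        have h4 : (t : ℝ)⁻¹ * (1 - Real.exp (-(t * lam i))) ≤ lam i := by
          rw [inv_mul_le_iff₀ ht']
          exact h2
        rw [Real.norm_eq_abs, Real.norm_eq_abs, abs_neg, abs_of_nonneg (h0 i), abs_le]
        constructor <;> linarith [h0 i]
    · intro h i
      have h1 : Tendsto (fun t : ℝ≥0 => ⟪b i, (t : ℝ)⁻¹ • (heat b h0 t x - x)⟫_ℂ) (𝓝[>] 0)
          (𝓝 ⟪b i, y⟫_ℂ) := tendsto_const_nhds.inner h
      have h2 := tendsto_nhds_unique h1 (hcoord i)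
      rw [inner_neg_right, h2]
      push_cast
      ring

/-- On an eigenvector of `A` every semigroup `e^{-tA}` is the exponential of the eigenvalue: the
orbit solves a linear ODE in the sense of right derivatives. -/
theorem IsExpNeg.apply_eigenvector {A : H →ₗ.[ℂ] H} {T : ℝ≥0 → H →L[ℂ] H} (hT : IsExpNeg A T)
    {v : H} {c : ℂ} (hv : (v, c • v) ∈ A.graph) (t : ℝ≥0) :
    T t v = Complex.exp (-(t * c)) • v := by
  have hgen : Tendsto (fun t : ℝ≥0 => (t : ℝ)⁻¹ • (T t v - v)) (𝓝[>] 0) (𝓝 (-(c • v))) := by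
    rwa [← hT.generator, mem_graph_neg, neg_neg]
  have hode := ODE_solution_unique (E := H) (v := fun _ x => (-c) • x) (K := ‖-c‖₊)
    (f := fun s : ℝ => T s.toNNReal v) (g := fun s : ℝ => Complex.exp (-(s * c)) • v)
    (a := 0) (b := t) (fun _ => lipschitzWith_smul (-c)) ?_ ?_ ?_ ?_ ?_
  · have := hode (Set.right_mem_Icc.mpr t.2)
    simpa using this
  · exact ((hT.continuous v).comp continuous_real_toNNReal).continuousOn
  · intro s hs
    rw [← hasDerivWithinAt_Ioi_iff_Ici, hasDerivWithinAt_iff_tendsto_slope' (by simp)]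
    have hlim : Tendsto (fun y : ℝ => (y - s).toNNReal) (𝓝[>] s) (𝓝[>] 0) := by
      refine tendsto_nhdsWithin_iff.mpr ⟨?_, ?_⟩
      · have : Continuous fun y : ℝ => (y - s).toNNReal := by fun_prop
        have h := this.tendsto s
        rw [sub_self, Real.toNNReal_zero] at h
        exact h.mono_left nhdsWithin_le_nhds
      · filter_upwards [self_mem_nhdsWithin] with y hy
        exact Real.toNNReal_pos.mpr (sub_pos.mpr hy)
    -- `(T (s + h) v - T s v) / h = T s ((T h v - v) / h)` tends to `T s (-c v)`.
    have h1 := ((T s.toNNReal).continuous.tendsto _).comp (hgen.comp hlim)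
    have h2 : T s.toNNReal (-(c • v)) = (-c) • T s.toNNReal v := by
      rw [← neg_smul, map_smul]
    rw [h2] at h1
    refine h1.congr' ?_
    filter_upwards [self_mem_nhdsWithin] with y hy
    have hy' : s < y := hy
    have h3 : y.toNNReal = s.toNNReal + (y - s).toNNReal := by
      rw [← Real.toNNReal_add hs.1 (sub_pos.mpr hy').le]
      congr 1
      ring
    simp only [Function.comp_apply, slope_def_module]
    rw [h3, hT.map_add, ContinuousLinearMap.mul_def, ContinuousLinearMap.comp_apply,
      Real.coe_toNNReal _ (sub_pos.mpr hy').le, ← map_sub]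
    exact (T s.toNNReal).map_smul_of_tower _ _
  · fun_prop
  · intro s _
    have h1 : HasDerivAt (fun s : ℝ => -((s : ℂ) * c)) (-c) s := by
      have := ((hasDerivAt_id (s : ℂ)).mul_const c).neg.comp_ofReal
      simpa using this
    have h2 := (h1.cexp.smul_const v).hasDerivWithinAt (s := Set.Ici s)
    rw [mul_comm, mul_smul] at h2
    exact h2
  · simp [hT.map_zero]

theorem IsExpNeg.eq_of_isDiagonal {A : H →ₗ.[ℂ] H} {b : HilbertBasis ι ℂ H} {lam : ι → ℝ}
    (hA : IsDiagonal A b lam) {S T : ℝ≥0 → H →L[ℂ] H} (hS : IsExpNeg A S) (hT : IsExpNeg A T) :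
    S = T := by
  funext t
  refine ContinuousLinearMap.ext_on (s := Set.range b) ?_ ?_
  · exact Submodule.dense_iff_topologicalClosure_eq_top.mpr b.dense_span
  · rintro _ ⟨i, rfl⟩
    rw [hS.apply_eigenvector (hA.mem_graph i), hT.apply_eigenvector (hA.mem_graph i)]

/-- A diagonal operator with nonnegative eigenvalues and finite heat traces generates a unique
semigroup, which is trace-class for positive times. -/
theorem IsDiagonal.exists_unique_traceClass {κ : Type u} [CompleteSpace H] {A : H →ₗ.[ℂ] H}
    {b : HilbertBasis κ ℂ H} {lam : κ → ℝ} (hA : IsDiagonal A b lam) (h0 : ∀ i, 0 ≤ lam i)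
    (htr : ∀ t : ℝ, 0 < t → Summable fun i => Real.exp (-(t * lam i))) :
    ∃ T : ℝ≥0 → H →L[ℂ] H, IsExpNeg A T ∧ (∀ T', IsExpNeg A T' → T' = T) ∧
      ∀ t : ℝ≥0, 0 < t → IsTraceClass (T t) := by
  have hT := hA.isExpNeg_heat h0
  refine ⟨_, hT, fun T' hT' => hT'.eq_of_isDiagonal hA hT, fun t ht => ⟨κ, b, ?_⟩⟩
  have hpos : 0 ≤ heat b h0 t := by
    rw [ContinuousLinearMap.nonneg_iff_isPositive]
    exact isPositive_diagOp b _ _ fun i => (Real.exp_pos _).le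
  rw [CFC.abs_of_nonneg _ hpos]
  refine (htr t ht).congr fun i => ?_
  rw [inner_heat, inner_self_eq_norm_sq_to_K, b.orthonormal.1]
  simp [-Complex.ofReal_exp]

end Diagonal

/-! ### Diagonalization by a compact resolvent -/

section Spectral

universe u

variable {H : Type u} [NormedAddCommGroup H] [InnerProductSpace ℂ H] [CompleteSpace H]

theorem exists_hilbertBasis_eigenvectors {R : H →L[ℂ] H} (hc : IsCompactOperator R)
    (hs : R.IsSymmetric) :
    ∃ (ι : Type u) (b : HilbertBasis ι ℂ H) (r : ι → ℝ), ∀ i, R (b i) = (r i : ℂ) • b i := by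
  let V : ℂ → Submodule ℂ H := fun μ => Module.End.eigenspace (R : Module.End ℂ H) μ
  have hV : ∀ μ, CompleteSpace (V μ) := fun μ => by
    have h : IsClosed (V μ : Set H) := by
      have : (V μ : Set H) = {x | R x = μ • x} := by
        ext x
        exact Module.End.mem_eigenspace_iff
      rw [this]
      exact isClosed_eq R.continuous (continuous_const_smul μ)
    exact h.completeSpace_coe
  choose w e he using fun μ => exists_hilbertBasis ℂ (V μ)
  have hort : Orthonormal ℂ fun a : Σ μ, w μ => ((e a.1 a.2 : V a.1) : H) :=
    hs.orthogonalFamily_eigenspaces.orthonormal_sigma_orthonormal fun μ => (e μ).orthonormal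
  have hbot : (Submodule.span ℂ (Set.range fun a : Σ μ, w μ => ((e a.1 a.2 : V a.1) : H)))ᗮ = ⊥ := by
    rw [eq_bot_iff, ← R.orthogonalComplement_iSup_eigenspaces_eq_bot hc hs]
    intro x hx
    rw [← Submodule.iInf_orthogonal, Submodule.mem_iInf]
    intro μ y hy
    -- `x` is orthogonal to the basis of the eigenspace, so its projection there vanishes.
    have h0 : (V μ).orthogonalProjectionOnto x = 0 := by
      refine eq_of_forall_inner_eq (e μ) fun i => ?_
      rw [inner_zero_right, Submodule.inner_orthogonalProjectionOnto_eq_of_mem_left]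
      exact hx _ (Submodule.subset_span ⟨⟨μ, i⟩, rfl⟩)
    exact (Submodule.orthogonalProjectionOnto_eq_zero_iff.mp h0) y hy
  refine ⟨Σ μ, w μ, HilbertBasis.mkOfOrthogonalEqBot hort hbot, fun a => a.1.re, fun a => ?_⟩
  rw [HilbertBasis.coe_mkOfOrthogonalEqBot]
  have hmem : R (e a.1 a.2 : V a.1) = a.1 • ((e a.1 a.2 : V a.1) : H) :=
    Module.End.mem_eigenspace_iff.mp (e a.1 a.2).2
  have hne : ((e a.1 a.2 : V a.1) : H) ≠ 0 := hort.ne_zero a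
  have hev : Module.End.HasEigenvalue (R : Module.End ℂ H) a.1 :=
    Module.End.hasEigenvalue_of_hasEigenvector ⟨(e a.1 a.2).2, hne⟩
  have hreal := Complex.conj_eq_iff_re.mp (hs.conj_eigenvalue_eq_self hev)
  rw [hmem, hreal]

/-- If `A` is symmetric and `A + c` has a compact everywhere defined right inverse `R`, then `A` is
diagonal in a Hilbert basis. Symmetry makes `A + c` injective, since its range is everything, so
that `R` is its two-sided inverse. -/
theorem exists_isDiagonal_of_compact_resolvent {A : H →ₗ.[ℂ] H}
    (hA : ∀ x y x' y', (x, y) ∈ A.graph → (x', y') ∈ A.graph → ⟪y, x'⟫_ℂ = ⟪x, y'⟫_ℂ)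
    {c : ℝ} {R : H →L[ℂ] H} (hR : IsCompactOperator R)
    (hAR : ∀ f, (R f, f - (c : ℂ) • R f) ∈ A.graph) :
    ∃ (ι : Type u) (b : HilbertBasis ι ℂ H) (lam : ι → ℝ), IsDiagonal A b lam := by
  -- `⟨R f, g⟩ = ⟨R f, (A + c) R g⟩ = ⟨(A + c) R f, R g⟩ = ⟨f, R g⟩`.
  have hs : R.IsSymmetric := fun f g => by
    have h := hA _ _ _ _ (hAR f) (hAR g)
    simp only [inner_sub_left, inner_sub_right, inner_smul_left, inner_smul_right,
      Complex.conj_ofReal] at h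
    exact (sub_left_injective h).symm
  have hinv : ∀ x y, (x, y) ∈ A.graph → x = R (y + (c : ℂ) • x) := fun x y hxy => by
    have h1 := A.graph.sub_mem hxy (hAR (y + (c : ℂ) • x))
    simp only [Prod.mk_sub_mk] at h1
    set z := x - R (y + (c : ℂ) • x) with hz
    have hz2 : y - (y + (c : ℂ) • x - (c : ℂ) • R (y + (c : ℂ) • x)) = -((c : ℂ) • z) := by
      rw [hz, smul_sub]
      abel
    rw [hz2] at h1
    -- `z` is in the kernel of `A + c`, hence orthogonal to the range of `A + c`, which contains `z`.
    have h2 := hA _ _ _ _ h1 (hAR z)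
    rw [inner_neg_left, inner_sub_right, inner_smul_left, inner_smul_right, Complex.conj_ofReal]
      at h2
    have h3 : ⟪z, z⟫_ℂ = 0 := by
      linear_combination -h2
    exact sub_eq_zero.mp (inner_self_eq_zero.mp h3)
  obtain ⟨ι, b, r, hb⟩ := exists_hilbertBasis_eigenvectors hR hs
  have hr : ∀ i, (r i : ℂ) ≠ 0 := fun i h0 => by
    have h1 := hAR (b i)
    rw [hb i, h0, zero_smul, smul_zero, sub_zero] at h1
    have h2 := LinearPMap.graph_fst_eq_zero_snd _ h1 rfl
    exact b.orthonormal.ne_zero i h2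
  have hRi : ∀ f i, ⟪b i, R f⟫_ℂ = r i * ⟪b i, f⟫_ℂ := fun f i => by
    have := hs (b i) f
    simp only [ContinuousLinearMap.coe_coe] at this
    rw [← this, hb i, inner_smul_left, Complex.conj_ofReal]
  refine ⟨ι, b, fun i => (r i)⁻¹ - c, fun x y => ?_⟩
  have hcoord : ∀ i, ⟪b i, x⟫_ℂ = ⟪b i, R (y + (c : ℂ) • x)⟫_ℂ ↔
      ⟪b i, y⟫_ℂ = (((r i)⁻¹ - c : ℝ) : ℂ) * ⟪b i, x⟫_ℂ := fun i => by
    rw [hRi, inner_add_right, inner_smul_right]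
    push_cast
    constructor <;> intro h
    · field_simp [hr i]
      linear_combination -h
    · rw [h]
      field_simp [hr i]
      ring
  constructor
  · intro hxy i
    exact (hcoord i).mp (congrArg _ (hinv x y hxy))
  · intro h
    have hx : x = R (y + (c : ℂ) • x) := eq_of_forall_inner_eq b fun i => (hcoord i).mpr (h i)
    have h1 := hAR (y + (c : ℂ) • x)
    rw [← hx, add_sub_cancel_right] at h1
    exact h1

end Spectral

/-! ### Ampliations -/

section Ampliation

variable {ι H : Type*} [NormedAddCommGroup H] [InnerProductSpace ℂ H]

theorem mem_graph_ampliation {N : ℕ} {A : H →ₗ.[ℂ] H} {ψ φ : PiLp 2 (fun _ : Fin N => H)} :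
    (ψ, φ) ∈ (ampliation N A).graph ↔ ∀ j, (ψ j, φ j) ∈ A.graph := by
  simp only [LinearPMap.mem_graph_iff]
  constructor
  · rintro ⟨x, rfl, rfl⟩ j
    exact ⟨⟨x.1 j, x.2 j⟩, rfl, rfl⟩
  · intro h
    choose x hx1 hx2 using h
    refine ⟨⟨ψ, fun j => ?_⟩, rfl, ?_⟩
    · rw [← hx1 j]
      exact (x j).2
    · ext j
      rw [← hx2 j]
      change A _ = _
      congr 1
      exact Subtype.ext (hx1 j).symm

theorem inner_single_left {N : ℕ} (j : Fin N) (x : H) (ψ : PiLp 2 (fun _ : Fin N => H)) :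
    ⟪(PiLp.single 2 j x : PiLp 2 (fun _ : Fin N => H)), ψ⟫_ℂ = ⟪x, ψ j⟫_ℂ := by
  rw [PiLp.inner_apply, Finset.sum_eq_single j]
  · simp
  · intro k _ hk
    simp [hk]
  · simp

theorem orthonormal_single (b : HilbertBasis ι ℂ H) (N : ℕ) :
    Orthonormal ℂ fun p : ι × Fin N =>
      (PiLp.single 2 p.2 (b p.1) : PiLp 2 (fun _ : Fin N => H)) := by
  classical
  rw [orthonormal_iff_ite]
  rintro ⟨i, j⟩ ⟨i', j'⟩
  rw [inner_single_left]
  by_cases hj : j = j'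
  · subst hj
    simp [orthonormal_iff_ite.mp b.orthonormal]
  · simp [hj]

/-- The Hilbert basis of `H ⊗ ℂ^N` of the vectors `b i ⊗ e_j`. -/
def ampBasis [CompleteSpace H] (b : HilbertBasis ι ℂ H) (N : ℕ) :
    HilbertBasis (ι × Fin N) ℂ (PiLp 2 (fun _ : Fin N => H)) :=
  HilbertBasis.mkOfOrthogonalEqBot (orthonormal_single b N) (by
    rw [eq_bot_iff]
    intro ψ hψ
    rw [Submodule.mem_bot]
    ext j
    refine eq_of_forall_inner_eq b fun i => ?_
    rw [← inner_single_left]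
    simpa using hψ _ (Submodule.subset_span ⟨(i, j), rfl⟩))

theorem inner_ampBasis [CompleteSpace H] (b : HilbertBasis ι ℂ H) (N : ℕ) (p : ι × Fin N)
    (ψ : PiLp 2 (fun _ : Fin N => H)) : ⟪ampBasis b N p, ψ⟫_ℂ = ⟪b p.1, ψ p.2⟫_ℂ := by
  rw [ampBasis, HilbertBasis.coe_mkOfOrthogonalEqBot, inner_single_left]

theorem IsDiagonal.ampliation [CompleteSpace H] {A : H →ₗ.[ℂ] H} {b : HilbertBasis ι ℂ H}
    {lam : ι → ℝ} (hA : IsDiagonal A b lam) (N : ℕ) :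
    IsDiagonal (ampliation N A) (ampBasis b N) fun p => lam p.1 := by
  intro ψ φ
  rw [mem_graph_ampliation]
  simp only [inner_ampBasis, Prod.forall]
  exact ⟨fun h i j => (hA _ _).mp (h j) i, fun h j => (hA _ _).mpr fun i => h i j⟩

end Ampliation

/-! ### Comparison of heat traces -/

section Trace

variable {ι κ H : Type*} [NormedAddCommGroup H] [InnerProductSpace ℂ H]

/-- Jensen's inequality for the exponential and a probability measure on a discrete set, from the
tangent line of `exp` at the mean. -/
theorem exp_neg_le_of_hasSum {w β : κ → ℝ} (hw : ∀ k, 0 ≤ w k) (hw1 : HasSum w 1) {m S : ℝ}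
    (hm : HasSum (fun k => w k * β k) m) (hS : HasSum (fun k => w k * Real.exp (-β k)) S) :
    Real.exp (-m) ≤ S := by
  have h : HasSum (fun k => (w k * (1 + m) - w k * β k) * Real.exp (-m))
      ((1 * (1 + m) - m) * Real.exp (-m)) :=
    ((hw1.mul_right _).sub hm).mul_right _
  rw [one_mul, add_sub_cancel_right, one_mul] at h
  refine hasSum_le (fun k => ?_) h hS
  have h1 := Real.add_one_le_exp (m - β k)
  have h2 : Real.exp (-β k) = Real.exp (m - β k) * Real.exp (-m) := by
    rw [← Real.exp_add]
    congr 1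
    ring
  rw [h2, ← mul_assoc, ← mul_sub]
  gcongr
  · exact hw k
  · linarith

/-- A Peierls–Berezin type comparison: if the numbers `lam i` dominate the expectations at `b i` of
an operator that is diagonal in the basis `e` with eigenvalues `β`, then `∑ e^{-lam i}` is at most
`∑ e^{-β k}`. -/
theorem summable_exp_neg_of_expectation_le (b : HilbertBasis ι ℂ H) (e : HilbertBasis κ ℂ H)
    {lam : ι → ℝ} {β : κ → ℝ} (hβ : Summable fun k => Real.exp (-β k))
    (h : ∀ i, ∃ m ≤ lam i, HasSum (fun k => ‖⟪e k, b i⟫_ℂ‖ ^ 2 * β k) m) :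
    Summable fun i => Real.exp (-lam i) := by
  have hcol : ∀ k, HasSum (fun i => ‖⟪e k, b i⟫_ℂ‖ ^ 2 * Real.exp (-β k)) (Real.exp (-β k)) :=
    fun k => by
      have h1 := (hasSum_norm_sq_inner b (e k)).mul_right (Real.exp (-β k))
      rw [e.orthonormal.1, one_pow, one_mul] at h1
      simpa only [norm_inner_symm (b _) (e k)] using h1
  have hprod : Summable fun p : κ × ι => ‖⟪e p.1, b p.2⟫_ℂ‖ ^ 2 * Real.exp (-β p.1) := by
    rw [summable_prod_of_nonneg fun p => by positivity]
    exact ⟨fun k => (hcol k).summable, hβ.congr fun k => ((hcol k).tsum_eq).symm⟩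
  have hprod' := hprod.prod_symm
  refine hprod'.prod.of_nonneg_of_le (fun i => (Real.exp_pos _).le) fun i => ?_
  obtain ⟨m, hm, hms⟩ := h i
  have hw1 := hasSum_norm_sq_inner e (b i)
  rw [b.orthonormal.1, one_pow] at hw1
  exact (Real.exp_le_exp.mpr (neg_le_neg hm)).trans
    (exp_neg_le_of_hasSum (fun k => by positivity) hw1 hms (hprod'.prod_factor i).hasSum)

end Trace

/-! ### Compactness of diagonal operators -/

section Compact

variable {ι H : Type*} [NormedAddCommGroup H] [InnerProductSpace ℂ H]

theorem isCompactOperator_diagOp_of_support_subset (b : HilbertBasis ι ℂ H) (m : ι → ℂ) {K : ℝ}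
    (hm : ∀ i, ‖m i‖ ≤ K) (s : Finset ι) (hs : ∀ i ∉ s, m i = 0) :
    IsCompactOperator (diagOp b m hm) := by
  classical
  have h : diagOp b m hm = ∑ i ∈ s,
      (ContinuousLinearMap.toSpanSingleton ℂ (m i • b i)) ∘L (innerSL ℂ (b i)) := by
    ext x
    refine eq_of_forall_inner_eq b fun j => ?_
    simp only [inner_diagOp, sum_apply, ContinuousLinearMap.comp_apply,
      ContinuousLinearMap.toSpanSingleton_apply, innerSL_apply_apply, inner_sum, inner_smul_right,
      orthonormal_iff_ite.mp b.orthonormal j, mul_ite, mul_one, mul_zero, Finset.sum_ite_eq]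
    split_ifs with hj
    · ring
    · rw [hs j hj, zero_mul]
  rw [h]
  refine (compactOperator (RingHom.id ℂ) H H).sum_mem fun i _ => ?_
  exact (isCompactOperator_of_locallyCompactSpace_rng
    (ContinuousLinearMap.toSpanSingleton ℂ (m i • b i))).comp_clm (innerSL ℂ (b i))

/-- A diagonal operator whose eigenvalues tend to zero is compact, as a norm limit of truncations of
finite rank. -/
theorem isCompactOperator_diagOp [CompleteSpace H] (b : HilbertBasis ι ℂ H) (m : ι → ℂ) {K : ℝ}
    (hm : ∀ i, ‖m i‖ ≤ K) (h0 : Tendsto m cofinite (𝓝 0)) :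
    IsCompactOperator (diagOp b m hm) := by
  classical
  have htr : ∀ (s : Finset ι) i, ‖(if i ∈ s then m i else 0)‖ ≤ K := fun s i => by
    split_ifs
    · exact hm i
    · simpa using (norm_nonneg _).trans (hm i)
  refine isCompactOperator_of_tendsto (l := (atTop : Filter (Finset ι)))
    (F := fun s => diagOp b (fun i => if i ∈ s then m i else 0) (htr s)) ?_
    (Eventually.of_forall fun s =>
      isCompactOperator_diagOp_of_support_subset b _ _ s fun i hi => if_neg hi)
  rw [Metric.tendsto_atTop]
  intro ε hε
  have hfin : {i | ε / 2 ≤ ‖m i‖}.Finite := by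
    have h1 := h0.eventually (Metric.ball_mem_nhds 0 (half_pos hε))
    rw [eventually_cofinite] at h1
    refine h1.subset fun i hi => ?_
    simpa using hi
  refine ⟨hfin.toFinset, fun s hs => ?_⟩
  have hd : ∀ i, ‖(if i ∈ s then 0 else -m i)‖ ≤ ε / 2 := fun i => by
    split_ifs with hi
    · simpa using (half_pos hε).le
    · rw [norm_neg]
      by_contra h
      exact hi (hs (hfin.mem_toFinset.mpr (not_le.mp h).le))
  have heq : diagOp b (fun i => if i ∈ s then m i else 0) (htr s) - diagOp b m hm
      = diagOp b _ hd := by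
    ext x
    refine eq_of_forall_inner_eq b fun j => ?_
    rw [sub_apply, inner_sub_right, inner_diagOp, inner_diagOp, inner_diagOp]
    split_ifs <;> ring
  rw [dist_eq_norm, heq]
  exact (norm_diagOp_le b _ hd (half_pos hε).le).trans_lt (half_lt_self hε)

end Compact

/-! ### Left Moyal multiplication -/

section Moyal

variable {n : ℕ} {Θ : Matrix (Fin n) (Fin n) ℝ}

theorem inner_wave_leftMulWave (Θ : Matrix (Fin n) (Fin n) ℝ) (k r : Fin n → ℤ) (ψ : TorusL2 n) :
    ⟪wave n r, leftMulWave Θ k ψ⟫_ℂ = phase Θ k (r - k) * ⟪wave n (r - k), ψ⟫_ℂ := by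
  classical
  have h : innerSL ℂ (wave n r) ∘L leftMulWave Θ k
      = phase Θ k (r - k) • innerSL ℂ (wave n (r - k)) := by
    refine ContinuousLinearMap.ext_on (s := Set.range (wave n))
      (Submodule.dense_iff_topologicalClosure_eq_top.mpr (wave n).dense_span) ?_
    rintro _ ⟨q, rfl⟩
    simp only [ContinuousLinearMap.comp_apply, innerSL_apply_apply, leftMulWave_apply_wave,
      smul_apply, inner_smul_right, smul_eq_mul,
      orthonormal_iff_ite.mp (wave n).orthonormal]
    by_cases hq : r = k + q
    · subst hq
      simp
    · have : r - k ≠ q := fun h => hq (by rw [← h]; abel)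
      simp [hq, this]
  exact congrArg (fun F => F ψ) h

theorem pairing_neg_left (Θ : Matrix (Fin n) (Fin n) ℝ) (k q : Fin n → ℤ) :
    pairing Θ (-k) q = -pairing Θ k q := by
  rw [pairing, pairing, ← neg_dotProduct]
  congr 1
  funext i
  simp

theorem pairing_self (hΘ : Θ.transpose = -Θ) (k : Fin n → ℤ) : pairing Θ k k = 0 := by
  have h : pairing Θ k k = -pairing Θ k k := by
    conv_lhs => rw [pairing, Matrix.dotProduct_mulVec, ← Matrix.mulVec_transpose, hΘ,
      Matrix.neg_mulVec, neg_dotProduct, dotProduct_comm]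
    rfl
  linarith

theorem pairing_add_right (Θ : Matrix (Fin n) (Fin n) ℝ) (k q q' : Fin n → ℤ) :
    pairing Θ k (q + q') = pairing Θ k q + pairing Θ k q' := by
  rw [pairing, pairing, pairing, ← dotProduct_add, ← Matrix.mulVec_add]
  congr 2
  funext i
  simp

theorem phase_neg_add (hΘ : Θ.transpose = -Θ) (k q : Fin n → ℤ) :
    phase Θ (-k) (q + k) = starRingEnd ℂ (phase Θ k q) := by
  rw [phase, phase, ← Complex.exp_conj, pairing_neg_left, pairing_add_right, pairing_self hΘ]
  congr 1
  rw [map_mul, map_neg, map_div₀, Complex.conj_I, Complex.conj_ofReal, map_ofNat]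
  push_cast
  ring

theorem star_leftMulWave (hΘ : Θ.transpose = -Θ) (k : Fin n → ℤ) :
    star (leftMulWave Θ k) = leftMulWave Θ (-k) := by
  ext1 ψ
  refine eq_of_forall_inner_eq (wave n) fun q => ?_
  rw [ContinuousLinearMap.star_eq_adjoint, ContinuousLinearMap.adjoint_inner_right,
    leftMulWave_apply_wave, inner_smul_left, inner_wave_leftMulWave, sub_neg_eq_add,
    phase_neg_add hΘ, add_comm]

/-- `L(a)* = L(a*)`. Skew-symmetry of `Θ` is what makes the adjoint of left multiplication by
`e^{ik·x}` equal to left multiplication by `e^{-ik·x}`, without an extra phase. -/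
theorem star_leftMul (hΘ : Θ.transpose = -Θ) (a : SmoothAlgebra n) :
    star (leftMul Θ a) = leftMul Θ (star a) := by
  have h1 := (summable_leftMul Θ a).hasSum.star
  have h2 := (Equiv.neg (Fin n → ℤ)).hasSum_iff.mpr (summable_leftMul Θ (star a)).hasSum
  refine h1.unique (h2.congr_fun fun k => ?_)
  change star (a.coeff k • leftMulWave Θ k) = star (a.coeff (- -k)) • leftMulWave Θ (-k)
  rw [star_smul, star_leftMulWave hΘ, neg_neg]

theorem leftMul_neg (Θ : Matrix (Fin n) (Fin n) ℝ) (a : SmoothAlgebra n) :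
    leftMul Θ (-a) = -leftMul Θ a := by
  rw [leftMul, leftMul, ← tsum_neg]
  refine tsum_congr fun k => ?_
  exact neg_smul _ _

theorem inner_leftMul_of_star_eq_neg (hΘ : Θ.transpose = -Θ) {a : SmoothAlgebra n}
    (ha : star a = -a) (ψ φ : TorusL2 n) : ⟪leftMul Θ a ψ, φ⟫_ℂ = -⟪ψ, leftMul Θ a φ⟫_ℂ := by
  have h := star_leftMul hΘ a
  rw [ha, leftMul_neg] at h
  rw [← ContinuousLinearMap.adjoint_inner_right, ← ContinuousLinearMap.star_eq_adjoint, h]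
  simp

/-- The partial derivative `∂_μ a` of an element of the smooth algebra. -/
def SmoothAlgebra.partialDeriv (a : SmoothAlgebra n) (μ : Fin n) : SmoothAlgebra n where
  coeff k := Complex.I * (k μ : ℂ) * a.coeff k
  rapidDecay N := by
    obtain ⟨C, hC⟩ := a.rapidDecay (N + 1)
    refine ⟨C, fun k => le_trans ?_ (hC k)⟩
    have h : ‖((k μ : ℤ) : ℂ)‖ ≤ 1 + ‖k‖ := by
      have := norm_le_pi_norm k μ
      rw [Complex.norm_intCast]
      rw [Int.norm_eq_abs] at this
      linarith
    rw [norm_mul, norm_mul, Complex.norm_I, one_mul, pow_succ, mul_assoc]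
    gcongr

theorem mem_derivGraph {μ : Fin n} {ψ φ : TorusL2 n} :
    (ψ, φ) ∈ derivGraph μ ↔ ∀ k, ⟪wave n k, φ⟫_ℂ = Complex.I * (k μ : ℂ) * ⟪wave n k, ψ⟫_ℂ := by
  simp only [← HilbertBasis.repr_apply_apply]
  rfl

theorem hasSum_inner_leftMul (Θ : Matrix (Fin n) (Fin n) ℝ) (a : SmoothAlgebra n) (ψ : TorusL2 n)
    (r : Fin n → ℤ) :
    HasSum (fun k => a.coeff k * (phase Θ k (r - k) * ⟪wave n (r - k), ψ⟫_ℂ))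
      ⟪wave n r, leftMul Θ a ψ⟫_ℂ := by
  have h := ((summable_leftMul Θ a).hasSum.mapL
    (ContinuousLinearMap.apply ℂ (TorusL2 n) ψ)).mapL (innerSL ℂ (wave n r))
  refine h.congr_fun fun k => ?_
  simp only [ContinuousLinearMap.apply_apply, smul_apply, innerSL_apply_apply,
    inner_smul_right, inner_wave_leftMulWave]

/-- The Leibniz rule `∂_μ (a ⋆ ψ) = ∂_μ a ⋆ ψ + a ⋆ ∂_μ ψ`. -/
theorem leftMul_mem_derivGraph (Θ : Matrix (Fin n) (Fin n) ℝ) (a : SmoothAlgebra n) {μ : Fin n}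
    {ψ φ : TorusL2 n} (h : (ψ, φ) ∈ derivGraph μ) :
    (leftMul Θ a ψ, leftMul Θ (a.partialDeriv μ) ψ + leftMul Θ a φ) ∈ derivGraph μ := by
  rw [mem_derivGraph] at h ⊢
  intro r
  rw [inner_add_right]
  refine ((hasSum_inner_leftMul Θ (a.partialDeriv μ) ψ r).add
    (hasSum_inner_leftMul Θ a φ r)).unique
    (((hasSum_inner_leftMul Θ a ψ r).mul_left (Complex.I * (r μ : ℂ))).congr_fun fun k => ?_)
  rw [h, SmoothAlgebra.partialDeriv]
  simp only [Pi.sub_apply]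
  push_cast
  ring

theorem inner_skew_of_mem_derivGraph {μ : Fin n} {ψ φ ψ' φ' : TorusL2 n}
    (h : (ψ, φ) ∈ derivGraph μ) (h' : (ψ', φ') ∈ derivGraph μ) : ⟪φ, ψ'⟫_ℂ = -⟪ψ, φ'⟫_ℂ := by
  rw [mem_derivGraph] at h h'
  refine ((wave n).hasSum_inner_mul_inner φ ψ').unique
    (((wave n).hasSum_inner_mul_inner ψ φ').neg.congr_fun fun k => ?_)
  rw [h', ← inner_conj_symm φ, h, map_mul, map_mul, inner_conj_symm, Complex.conj_I, map_intCast]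
  ring

theorem hasSum_of_mem_derivGraph {μ : Fin n} {ψ φ : TorusL2 n} (h : (ψ, φ) ∈ derivGraph μ) :
    HasSum (fun k => (k μ : ℝ) ^ 2 * ‖⟪wave n k, ψ⟫_ℂ‖ ^ 2) (‖φ‖ ^ 2) := by
  rw [mem_derivGraph] at h
  refine (hasSum_norm_sq_inner (wave n) φ).congr_fun fun k => ?_
  rw [h, norm_mul, norm_mul, Complex.norm_I, one_mul, mul_pow, Complex.norm_intCast, sq_abs]

theorem mem_graph_covDeriv {ω : Fin n → SmoothAlgebra n} {μ : Fin n} {ψ φ : TorusL2 n} :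
    (ψ, φ) ∈ (covDeriv Θ ω μ).graph ↔ (ψ, φ - leftMul Θ (ω μ) ψ) ∈ derivGraph μ := by
  rw [covDeriv, mem_graph_add]
  simp only [graph_pd, mem_graph_everywhere]
  constructor
  · rintro ⟨y, _, hy, rfl, rfl⟩
    rwa [add_sub_cancel_right]
  · intro h
    exact ⟨_, _, h, rfl, (sub_add_cancel _ _).symm⟩

theorem inner_skew_of_mem_graph_covDeriv (hΘ : Θ.transpose = -Θ) {ω : Fin n → SmoothAlgebra n}
    {μ : Fin n} (hω : star (ω μ) = -ω μ) {ψ φ ψ' φ' : TorusL2 n}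
    (h : (ψ, φ) ∈ (covDeriv Θ ω μ).graph) (h' : (ψ', φ') ∈ (covDeriv Θ ω μ).graph) :
    ⟪φ, ψ'⟫_ℂ = -⟪ψ, φ'⟫_ℂ := by
  rw [mem_graph_covDeriv] at h h'
  have h1 := inner_skew_of_mem_derivGraph h h'
  have h2 := inner_leftMul_of_star_eq_neg hΘ hω ψ ψ'
  rw [inner_sub_left, inner_sub_right] at h1
  linear_combination h1 + h2

theorem mem_graph_scalarLaplacian {ω : Fin n → SmoothAlgebra n} {E : SmoothAlgebra n}
    {ψ χ : TorusL2 n} : (ψ, χ) ∈ (scalarLaplacian Θ ω E).graph ↔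
      ∃ u v : Fin n → TorusL2 n, (∀ μ, (ψ, u μ) ∈ (covDeriv Θ ω μ).graph) ∧
        (∀ μ, (u μ, v μ) ∈ (covDeriv Θ ω μ).graph) ∧ χ = -(∑ μ, v μ + leftMul Θ E ψ) := by
  rw [scalarLaplacian, mem_graph_neg, mem_graph_add]
  simp only [mem_graph_everywhere, mem_graph_sum, mem_graph_pcomp, Finset.mem_univ, true_imp_iff]
  constructor
  · rintro ⟨_, _, ⟨v, hv, rfl⟩, rfl, h⟩
    choose u hu huv using hv
    exact ⟨u, v, hu, huv, by rw [← h, neg_neg]⟩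
  · rintro ⟨u, v, hu, huv, rfl⟩
    exact ⟨_, _, ⟨v, fun μ => ⟨u μ, hu μ, huv μ⟩, rfl⟩, rfl, neg_neg _⟩

/-- The generalized Laplacian is symmetric on its natural domain. -/
theorem scalarLaplacian_symmetric (hΘ : Θ.transpose = -Θ) {ω : Fin n → SmoothAlgebra n}
    (hω : ∀ μ, star (ω μ) = -ω μ) {E : SmoothAlgebra n} (hE : (-leftMul Θ E).IsPositive)
    (ψ χ ψ' χ' : TorusL2 n) (h : (ψ, χ) ∈ (scalarLaplacian Θ ω E).graph)
    (h' : (ψ', χ') ∈ (scalarLaplacian Θ ω E).graph) : ⟪χ, ψ'⟫_ℂ = ⟪ψ, χ'⟫_ℂ := by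
  obtain ⟨u, v, hu, hv, rfl⟩ := mem_graph_scalarLaplacian.mp h
  obtain ⟨u', v', hu', hv', rfl⟩ := mem_graph_scalarLaplacian.mp h'
  have h1 : ∀ μ, ⟪v μ, ψ'⟫_ℂ = ⟪ψ, v' μ⟫_ℂ := fun μ => by
    rw [inner_skew_of_mem_graph_covDeriv hΘ (hω μ) (hv μ) (hu' μ),
      inner_skew_of_mem_graph_covDeriv hΘ (hω μ) (hu μ) (hv' μ), neg_neg]
  have h2 := hE.inner_left_eq_inner_right ψ ψ'
  simp only [neg_apply, inner_neg_left, inner_neg_right] at h2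
  simp only [inner_neg_left, inner_neg_right, inner_add_left, inner_add_right, sum_inner,
    inner_sum, h1]
  linear_combination h2

/-- The number `|k|² = ∑_μ k_μ²`, the eigenvalue of the flat Laplacian at `e^{ik·x}`. -/
def normSq (k : Fin n → ℤ) : ℝ := ∑ μ, (k μ : ℝ) ^ 2

/-- The energy bound `∑ ‖(∂_μ + L(ω_μ)) ψ‖² ≤ ⟨ψ, Aψ⟩`, from integration by parts and `E ≤ 0`. -/
theorem sum_norm_sq_covDeriv_le (hΘ : Θ.transpose = -Θ) {ω : Fin n → SmoothAlgebra n}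
    (hω : ∀ μ, star (ω μ) = -ω μ) {E : SmoothAlgebra n} (hE : (-leftMul Θ E).IsPositive)
    {ψ χ : TorusL2 n} (h : (ψ, χ) ∈ (scalarLaplacian Θ ω E).graph) :
    ∃ u : Fin n → TorusL2 n, (∀ μ, (ψ, u μ) ∈ (covDeriv Θ ω μ).graph) ∧
      ∑ μ, ‖u μ‖ ^ 2 ≤ (⟪ψ, χ⟫_ℂ).re := by
  obtain ⟨u, v, hu, hv, rfl⟩ := mem_graph_scalarLaplacian.mp h
  refine ⟨u, hu, ?_⟩
  have h1 : ∀ μ, ⟪ψ, v μ⟫_ℂ = -((‖u μ‖ ^ 2 : ℝ) : ℂ) := fun μ => by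
    have := inner_skew_of_mem_graph_covDeriv hΘ (hω μ) (hu μ) (hv μ)
    rw [inner_self_eq_norm_sq_to_K] at this
    rw [← neg_eq_iff_eq_neg, ← this]
    simp
  have h2 := hE.re_inner_nonneg_right ψ
  rw [neg_apply, inner_neg_right] at h2
  rw [inner_neg_right, inner_add_right, inner_sum]
  simp only [h1, Finset.sum_neg_distrib, ← Complex.ofReal_sum, neg_add, neg_neg, Complex.add_re,
    Complex.ofReal_re]
  exact le_add_of_nonneg_right h2

/-- Gårding's inequality `⟨ψ, Aψ⟩ ≥ ½ ‖∇ψ‖² - C ‖ψ‖²` for the generalized Laplacian `A`, in terms of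
the Fourier coefficients of `ψ`. -/
theorem exists_hasSum_le_inner_scalarLaplacian (hΘ : Θ.transpose = -Θ)
    {ω : Fin n → SmoothAlgebra n}
    (hω : ∀ μ, star (ω μ) = -ω μ) {E : SmoothAlgebra n} (hE : (-leftMul Θ E).IsPositive)
    {ψ χ : TorusL2 n} (h : (ψ, χ) ∈ (scalarLaplacian Θ ω E).graph) :
    ∃ m ≤ (⟪ψ, χ⟫_ℂ).re, HasSum (fun k => ‖⟪wave n k, ψ⟫_ℂ‖ ^ 2 *
      (normSq k / 2 - ∑ μ, ‖leftMul Θ (ω μ)‖ ^ 2)) m := by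
  obtain ⟨u, hu, hle⟩ := sum_norm_sq_covDeriv_le hΘ hω hE h
  have h1 := hasSum_sum (s := Finset.univ) fun μ _ =>
    hasSum_of_mem_derivGraph (mem_graph_covDeriv.mp (hu μ))
  have h2 := (h1.div_const 2).sub
    ((hasSum_norm_sq_inner (wave n) ψ).mul_right (∑ μ, ‖leftMul Θ (ω μ)‖ ^ 2))
  refine ⟨_, ?_, h2.congr_fun fun k => ?_⟩
  · refine le_trans ?_ hle
    rw [sub_le_iff_le_add, Finset.mul_sum, ← Finset.sum_add_distrib, Finset.sum_div]
    refine Finset.sum_le_sum fun μ _ => ?_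
    have h3 : ‖u μ - leftMul Θ (ω μ) ψ‖ ≤ ‖u μ‖ + ‖leftMul Θ (ω μ)‖ * ‖ψ‖ :=
      (norm_sub_le _ _).trans (add_le_add_right ((leftMul Θ (ω μ)).le_opNorm ψ) _)
    have h4 := pow_le_pow_left₀ (norm_nonneg _) h3 2
    nlinarith [sq_nonneg (‖u μ‖ - ‖leftMul Θ (ω μ)‖ * ‖ψ‖)]
  · rw [normSq, ← Finset.sum_mul]
    ring

end Moyal

/-! ### Gaussian sums over `ℤⁿ` -/

section Gaussian

theorem summable_prod_int {f : ℤ → ℝ} (h0 : ∀ m, 0 ≤ f m) (hf : Summable f) (n : ℕ) :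
    Summable fun k : Fin n → ℤ => ∏ μ, f (k μ) := by
  induction n with
  | zero => exact Summable.of_finite
  | succ n ih =>
    rw [← (Fin.consEquiv fun _ : Fin (n + 1) => ℤ).summable_iff]
    refine (hf.mul_of_nonneg ih h0 fun k => Finset.prod_nonneg fun μ _ => h0 _).congr fun p => ?_
    rw [Function.comp_apply, Fin.prod_univ_succ]
    rfl

theorem summable_exp_neg_mul_sq {a : ℝ} (ha : 0 < a) :
    Summable fun m : ℤ => Real.exp (-(a * (m : ℝ) ^ 2)) := by
  have h : Summable fun m : ℕ => Real.exp (-(a * (m : ℝ) ^ 2)) := by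
    refine (Real.summable_exp_nat_mul_iff.mpr (neg_lt_zero.mpr ha)).of_nonneg_of_le
      (fun m => (Real.exp_pos _).le) fun m => Real.exp_le_exp.mpr ?_
    have h1 : (m : ℝ) ≤ (m : ℝ) ^ 2 := by
      exact_mod_cast Nat.le_self_pow two_ne_zero m
    nlinarith
  refine Summable.of_nat_of_neg ?_ ?_ <;> simpa using h

theorem summable_exp_neg_mul_normSq {a : ℝ} (ha : 0 < a) (n : ℕ) :
    Summable fun k : Fin n → ℤ => Real.exp (-(a * normSq k)) := by
  refine (summable_prod_int (fun m => (Real.exp_pos _).le)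
    (summable_exp_neg_mul_sq ha) n).congr fun k => ?_
  rw [← Real.exp_sum, normSq, Finset.mul_sum, Finset.sum_neg_distrib]

theorem tendsto_normSq_cofinite (n : ℕ) :
    Tendsto (normSq : (Fin n → ℤ) → ℝ) cofinite atTop := by
  have h := (summable_exp_neg_mul_normSq one_pos n).tendsto_cofinite_zero
  rw [Real.tendsto_exp_comp_nhds_zero] at h
  simpa using tendsto_neg_atBot_iff.mp h

end Gaussian

/-! ### The resolvent of the generalized Laplacian -/

section Resolvent

variable {n : ℕ}

theorem normSq_nonneg (k : Fin n → ℤ) : 0 ≤ normSq k :=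
  Finset.sum_nonneg fun _ _ => sq_nonneg _

theorem sq_le_normSq (k : Fin n → ℤ) (μ : Fin n) : (k μ : ℝ) ^ 2 ≤ normSq k :=
  Finset.single_le_sum (f := fun μ => (k μ : ℝ) ^ 2) (fun _ _ => sq_nonneg _) (Finset.mem_univ μ)

theorem norm_inv_normSq_add_le {s : ℝ} (hs : 1 ≤ s) (k : Fin n → ℤ) :
    ‖((normSq k + s ^ 2 : ℝ) : ℂ)⁻¹‖ ≤ s⁻¹ := by
  have h := normSq_nonneg k
  rw [norm_inv, Complex.norm_real, Real.norm_of_nonneg (by positivity)]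
  gcongr
  nlinarith

theorem norm_mul_inv_normSq_add_le {s : ℝ} (hs : 1 ≤ s) (μ : Fin n) (k : Fin n → ℤ) :
    ‖Complex.I * (k μ : ℂ) * ((normSq k + s ^ 2 : ℝ) : ℂ)⁻¹‖ ≤ s⁻¹ := by
  have h := normSq_nonneg k
  have h1 := sq_le_normSq k μ
  rw [norm_mul, norm_mul, Complex.norm_I, one_mul, Complex.norm_intCast, norm_inv,
    Complex.norm_real, Real.norm_of_nonneg (by positivity), ← div_eq_mul_inv, ← one_div,
    div_le_div_iff₀ (by positivity) (by positivity), one_mul]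
  rw [← sq_abs] at h1
  nlinarith [sq_nonneg (|(k μ : ℝ)| - s), abs_nonneg (k μ : ℝ)]

theorem norm_sq_mul_inv_normSq_add_le {s : ℝ} (hs : 1 ≤ s) (μ : Fin n) (k : Fin n → ℤ) :
    ‖(Complex.I * (k μ : ℂ)) ^ 2 * ((normSq k + s ^ 2 : ℝ) : ℂ)⁻¹‖ ≤ 1 := by
  have h := normSq_nonneg k
  have h1 := sq_le_normSq k μ
  rw [norm_mul, norm_pow, norm_mul, Complex.norm_I, one_mul, Complex.norm_intCast, norm_inv,
    Complex.norm_real, Real.norm_of_nonneg (by positivity), ← div_eq_mul_inv,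
    div_le_one (by positivity), sq_abs]
  nlinarith

/-- The resolvent `(-∑ ∂_μ² + s²)⁻¹` of the flat Laplacian. -/
def flatResolvent {s : ℝ} (hs : 1 ≤ s) : TorusL2 n →L[ℂ] TorusL2 n :=
  diagOp (wave n) _ (norm_inv_normSq_add_le hs)

/-- The operator `∂_μ (-∑ ∂_ν² + s²)⁻¹`. -/
def derivFlatResolvent {s : ℝ} (hs : 1 ≤ s) (μ : Fin n) : TorusL2 n →L[ℂ] TorusL2 n :=
  diagOp (wave n) _ (norm_mul_inv_normSq_add_le hs μ)

/-- The operator `∂_μ² (-∑ ∂_ν² + s²)⁻¹`. -/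
def derivSqFlatResolvent {s : ℝ} (hs : 1 ≤ s) (μ : Fin n) : TorusL2 n →L[ℂ] TorusL2 n :=
  diagOp (wave n) _ (norm_sq_mul_inv_normSq_add_le hs μ)

variable {s : ℝ} (hs : 1 ≤ s)

theorem flatResolvent_mem_derivGraph (μ : Fin n) (f : TorusL2 n) :
    (flatResolvent hs f, derivFlatResolvent hs μ f) ∈ derivGraph μ := by
  rw [mem_derivGraph]
  intro k
  rw [flatResolvent, derivFlatResolvent, inner_diagOp, inner_diagOp]
  ring

theorem derivFlatResolvent_mem_derivGraph (μ : Fin n) (f : TorusL2 n) :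
    (derivFlatResolvent hs μ f, derivSqFlatResolvent hs μ f) ∈ derivGraph μ := by
  rw [mem_derivGraph]
  intro k
  rw [derivFlatResolvent, derivSqFlatResolvent, inner_diagOp, inner_diagOp]
  ring

theorem sum_derivSqFlatResolvent (f : TorusL2 n) :
    ∑ μ, derivSqFlatResolvent hs μ f = ((s ^ 2 : ℝ) : ℂ) • flatResolvent hs f - f := by
  refine eq_of_forall_inner_eq (wave n) fun k => ?_
  simp only [inner_sum, inner_sub_right, inner_smul_right, derivSqFlatResolvent, flatResolvent,
    inner_diagOp, ← Finset.sum_mul, mul_pow, Complex.I_sq, ← Finset.mul_sum]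
  have h : ((normSq k + s ^ 2 : ℝ) : ℂ) ≠ 0 := by
    have := normSq_nonneg k
    exact_mod_cast (by positivity : normSq k + s ^ 2 ≠ 0)
  have h2 : ∑ μ, (k μ : ℂ) ^ 2 = (normSq k : ℂ) := by
    rw [normSq]
    push_cast
    rfl
  rw [h2]
  field_simp
  push_cast
  ring

theorem isCompactOperator_flatResolvent :
    IsCompactOperator (flatResolvent hs : TorusL2 n →L[ℂ] TorusL2 n) := by
  refine isCompactOperator_diagOp _ _ _ ?_
  have h := (tendsto_inv_atTop_zero.comp
    (tendsto_atTop_add_const_right _ (s ^ 2) (tendsto_normSq_cofinite n)))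
  have h2 := (Complex.continuous_ofReal.tendsto 0).comp h
  rw [Complex.ofReal_zero] at h2
  refine h2.congr fun k => ?_
  simp

/-- The operator `K` such that `(A + s²) (-∑ ∂_μ² + s²)⁻¹ = 1 - K` for the generalized Laplacian
`A`. -/
def perturbation (Θ : Matrix (Fin n) (Fin n) ℝ) (ω : Fin n → SmoothAlgebra n)
    (E : SmoothAlgebra n) : TorusL2 n →L[ℂ] TorusL2 n :=
  ∑ μ, (leftMul Θ ((ω μ).partialDeriv μ) ∘L flatResolvent hs
    + leftMul Θ (ω μ) ∘L derivFlatResolvent hs μ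
    + leftMul Θ (ω μ) ∘L (derivFlatResolvent hs μ + leftMul Θ (ω μ) ∘L flatResolvent hs))
  + leftMul Θ E ∘L flatResolvent hs

theorem flatResolvent_mem_graph (Θ : Matrix (Fin n) (Fin n) ℝ) (ω : Fin n → SmoothAlgebra n)
    (E : SmoothAlgebra n) (f : TorusL2 n) :
    (flatResolvent hs f,
      f - perturbation hs Θ ω E f - ((s ^ 2 : ℝ) : ℂ) • flatResolvent hs f) ∈
        (scalarLaplacian Θ ω E).graph := by
  rw [mem_graph_scalarLaplacian]
  refine ⟨fun μ => derivFlatResolvent hs μ f + leftMul Θ (ω μ) (flatResolvent hs f),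
    fun μ => derivSqFlatResolvent hs μ f + (leftMul Θ ((ω μ).partialDeriv μ) (flatResolvent hs f)
      + leftMul Θ (ω μ) (derivFlatResolvent hs μ f))
      + leftMul Θ (ω μ) (derivFlatResolvent hs μ f + leftMul Θ (ω μ) (flatResolvent hs f)),
    fun μ => ?_, fun μ => ?_, ?_⟩
  · rw [mem_graph_covDeriv, add_sub_cancel_right]
    exact flatResolvent_mem_derivGraph hs μ f
  · rw [mem_graph_covDeriv, add_sub_cancel_right]
    have h := (derivGraph μ).add_mem (derivFlatResolvent_mem_derivGraph hs μ f)
      (leftMul_mem_derivGraph Θ (ω μ) (flatResolvent_mem_derivGraph hs μ f))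
    rwa [Prod.mk_add_mk] at h
  · simp only [Finset.sum_add_distrib, sum_derivSqFlatResolvent, perturbation, add_apply,
      sum_apply, ContinuousLinearMap.comp_apply]
    abel

theorem norm_comp_le_mul {H : Type*} [NormedAddCommGroup H] [NormedSpace ℂ H] (L : H →L[ℂ] H)
    {F : H →L[ℂ] H} {c : ℝ} (hF : ‖F‖ ≤ c) : ‖L ∘L F‖ ≤ ‖L‖ * c :=
  (L.opNorm_comp_le F).trans (mul_le_mul_of_nonneg_left hF (norm_nonneg L))

theorem norm_comp_add_comp_add_comp_le {H : Type*} [NormedAddCommGroup H] [NormedSpace ℂ H]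
    (L L' : H →L[ℂ] H) {G D : H →L[ℂ] H} {c : ℝ} (hG : ‖G‖ ≤ c) (hD : ‖D‖ ≤ c) :
    ‖L' ∘L G + L ∘L D + L ∘L (D + L ∘L G)‖ ≤ (‖L'‖ + ‖L‖ + ‖L‖ * (1 + ‖L‖)) * c := by
  have h1 : ‖D + L ∘L G‖ ≤ (1 + ‖L‖) * c := by
    rw [add_mul, one_mul]
    exact (norm_add_le _ _).trans (add_le_add hD (norm_comp_le_mul L hG))
  rw [add_mul, add_mul, mul_assoc]
  exact norm_add₃_le.trans (add_le_add_three (norm_comp_le_mul L' hG) (norm_comp_le_mul L hD)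
    (norm_comp_le_mul L h1))

theorem norm_perturbation_le (Θ : Matrix (Fin n) (Fin n) ℝ) (ω : Fin n → SmoothAlgebra n)
    (E : SmoothAlgebra n) : ‖perturbation hs Θ ω E‖ ≤
      (∑ μ, (‖leftMul Θ ((ω μ).partialDeriv μ)‖ + ‖leftMul Θ (ω μ)‖
        + ‖leftMul Θ (ω μ)‖ * (1 + ‖leftMul Θ (ω μ)‖)) + ‖leftMul Θ E‖) * s⁻¹ := by
  have hs0 : 0 ≤ s⁻¹ := by positivity
  have hG : ‖(flatResolvent hs : TorusL2 n →L[ℂ] TorusL2 n)‖ ≤ s⁻¹ := norm_diagOp_le _ _ _ hs0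
  have hD : ∀ μ : Fin n, ‖derivFlatResolvent hs μ‖ ≤ s⁻¹ := fun μ => norm_diagOp_le _ _ _ hs0
  rw [add_mul, Finset.sum_mul]
  refine (norm_add_le _ _).trans (add_le_add ((norm_sum_le _ _).trans
    (Finset.sum_le_sum fun μ _ => ?_)) (norm_comp_le_mul _ hG))
  exact norm_comp_add_comp_add_comp_le _ _ hG (hD μ)

/-- The generalized Laplacian, shifted by a large constant, has a compact right inverse: for large
`s` the operator `K` of `perturbation` has norm less than one, and `(-∑ ∂_μ² + s²)⁻¹ (1 - K)⁻¹` is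
such an inverse. -/
theorem exists_compact_resolvent (Θ : Matrix (Fin n) (Fin n) ℝ) (ω : Fin n → SmoothAlgebra n)
    (E : SmoothAlgebra n) : ∃ (c : ℝ) (R : TorusL2 n →L[ℂ] TorusL2 n), IsCompactOperator R ∧
      ∀ f, (R f, f - (c : ℂ) • R f) ∈ (scalarLaplacian Θ ω E).graph := by
  set M : ℝ := ∑ μ, (‖leftMul Θ ((ω μ).partialDeriv μ)‖ + ‖leftMul Θ (ω μ)‖
        + ‖leftMul Θ (ω μ)‖ * (1 + ‖leftMul Θ (ω μ)‖)) + ‖leftMul Θ E‖ with hM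
  have hM0 : 0 ≤ M := by positivity
  -- With `s = M + 1` the bound `M * s⁻¹` on the norm of the perturbation is less than one.
  have hs : 1 ≤ M + 1 := by linarith
  have hlt : ‖perturbation hs Θ ω E‖ < 1 := by
    refine (norm_perturbation_le hs Θ ω E).trans_lt ?_
    rw [← hM, ← div_eq_mul_inv, div_lt_one (by positivity)]
    linarith
  obtain ⟨W, hW⟩ := (isUnit_one_sub_of_norm_lt_one hlt).exists_right_inv
  refine ⟨(M + 1) ^ 2, flatResolvent hs ∘L W, (isCompactOperator_flatResolvent hs).comp_clm W,
    fun f => ?_⟩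
  have h := flatResolvent_mem_graph hs Θ ω E (W f)
  have h1 : W f - perturbation hs Θ ω E (W f) = f := congrArg (fun F => F f) hW
  rwa [h1] at h

/-- The generalized Laplacian is diagonal in a Hilbert basis, with nonnegative eigenvalues and finite
heat traces. -/
theorem exists_isDiagonal_scalarLaplacian {Θ : Matrix (Fin n) (Fin n) ℝ} (hΘ : Θ.transpose = -Θ)
    {ω : Fin n → SmoothAlgebra n} (hω : ∀ μ, star (ω μ) = -ω μ)
    {E : SmoothAlgebra n} (hE : (-leftMul Θ E).IsPositive) :
    ∃ (ι : Type) (b : HilbertBasis ι ℂ (TorusL2 n)) (lam : ι → ℝ),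
      IsDiagonal (scalarLaplacian Θ ω E) b lam ∧ (∀ i, 0 ≤ lam i) ∧
      ∀ t : ℝ, 0 < t → Summable fun i => Real.exp (-(t * lam i)) := by
  obtain ⟨c, R, hR, hAR⟩ := exists_compact_resolvent Θ ω E
  obtain ⟨ι, b, lam, hA⟩ :=
    exists_isDiagonal_of_compact_resolvent (scalarLaplacian_symmetric hΘ hω hE) hR hAR
  have hexp : ∀ i, (⟪b i, (lam i : ℂ) • b i⟫_ℂ).re = lam i := fun i => by
    rw [inner_smul_right, inner_self_eq_norm_sq_to_K, b.orthonormal.1]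
    simp
  refine ⟨ι, b, lam, hA, fun i => ?_, fun t ht => ?_⟩
  · obtain ⟨u, _, hu⟩ := sum_norm_sq_covDeriv_le hΘ hω hE (hA.mem_graph i)
    rw [hexp] at hu
    exact (Finset.sum_nonneg fun μ _ => by positivity).trans hu
  · set C := ∑ μ, ‖leftMul Θ (ω μ)‖ ^ 2 with hC
    refine summable_exp_neg_of_expectation_le b (wave n)
      (β := fun k => t * (normSq k / 2 - C)) ?_ fun i => ?_
    · refine ((summable_exp_neg_mul_normSq (half_pos ht) n).mul_right
        (Real.exp (t * C))).congr fun k => ?_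
      rw [← Real.exp_add]
      congr 1
      ring
    · obtain ⟨m, hm, hsum⟩ := exists_hasSum_le_inner_scalarLaplacian hΘ hω hE (hA.mem_graph i)
      rw [hexp] at hm
      refine ⟨t * m, by gcongr, (hsum.mul_left t).congr_fun fun k => ?_⟩
      ring

end Resolvent

end NCTorus

end

theorem theorem3p4 (n : ℕ) (Θ : Matrix (Fin n) (Fin n) ℝ) (hΘ : Θ.transpose = -Θ)
    (ω : Fin n → NCTorus.SmoothAlgebra n) (hω : ∀ μ, star (ω μ) = -ω μ)
    (E : NCTorus.SmoothAlgebra n) (hE : (-NCTorus.leftMul Θ E).IsPositive) :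
    ∃ T : ℝ≥0 → NCTorus.SpinorL2 n →L[ℂ] NCTorus.SpinorL2 n,
      NCTorus.IsExpNeg (NCTorus.laplacian Θ ω E) T ∧
      (∀ T', NCTorus.IsExpNeg (NCTorus.laplacian Θ ω E) T' → T' = T) ∧
      ∀ t : ℝ≥0, 0 < t → NCTorus.IsTraceClass (T t) := by
  obtain ⟨ι, b, lam, hA, h0, htr⟩ := NCTorus.exists_isDiagonal_scalarLaplacian hΘ hω hE
  refine (hA.ampliation (2 ^ (n / 2))).exists_unique_traceClass (fun p => h0 p.1) fun t ht => ?_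
  have h := (htr t ht).mul_of_nonneg (g := fun _ : Fin (2 ^ (n / 2)) => (1 : ℝ)) Summable.of_finite
    (fun _ => (Real.exp_pos _).le) fun _ => zero_le_one
  simpa using h
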